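/- Call a finite set $\mathcal F$ of finite sets (edges) a hypergraph. It is $k$-uniform if each of its edges has exactly $k$ elements, and $[a,b]$-almost intersecting if every $A\in\mathcal F$ satisfies $a\le|\{B\in\mathcal F: A\cap B=\emptyset\}|\le b$; it is $s$-almost intersecting if it is $[s,s]$-almost intersecting. Given disjoint finite sets $A,B$ with $|A|=2k-2$ and $|B|\ge s+1$, and a map $f:\binom{A}{k-1}\to\binom{B}{s+1}$ with $f(S)=f(A\setminus S)$ for every $S\in\binom{A}{k-1}$, put $$\mathcal M_f=\Big\{S\cup\{x\}: S\in\tbinom{A}{k-1},\ x\in f(S)\Big\}.$$ **Theorem.** Fix an integer $k>2$. There exist constants $R=R(k)$ and $s_0=s_0(k)$ such that for every integer $s>s_0$ the following hold. 1. Every $k$-uniform $[R,s]$-almost intersecting hypergraph has at most $(s+1)\binom{2k-2}{k-1}$ edges. 2. The $k$-uniform $[R,s]$-almost intersecting hypergraphs with exactly $(s+1)\binom{2k-2}{k-1}$ edges are exactly the hypergraphs $\mathcal M_f$, for $A,B,f$ as above. 3. Every such $\mathcal M_f$ is $s$-almost intersecting. -/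

import Mathlib

/-- A finite hypergraph `F` is `[a,b]`-almost intersecting if every edge of `F` is disjoint from
at least `a` and at most `b` edges of `F`. -/
def IsAlmostIntersecting {V : Type*} [DecidableEq V] (a b : ℕ) (F : Finset (Finset V)) : Prop :=
  ∀ A ∈ F, a ≤ (F.filter (fun B => A ∩ B = ∅)).card ∧ (F.filter (fun B => A ∩ B = ∅)).card ≤ b

/-- The hypergraph `M_f = {S ∪ {x} : S a (k-1)-subset of A, x ∈ f S}`. -/
def doubleStarFamily {V : Type*} [DecidableEq V] (k : ℕ) (A : Finset V)
    (f : Finset V → Finset V) : Finset (Finset V) :=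
  (A.powersetCard (k - 1)).biUnion (fun S => (f S).image (fun x => S ∪ {x}))

/-- `F` has the form `M_f`, where `A` and `B` are disjoint sets with `|A| = 2k-2` and
`|B| ≥ s+1`, and `f` maps the `(k-1)`-subsets of `A` to `(s+1)`-subsets of `B` so that
`f S = f (A \ S)`. (The values of `f` on other sets are irrelevant.) -/
def IsDoubleStarFamily {V : Type*} [DecidableEq V] (k s : ℕ) (F : Finset (Finset V)) : Prop :=
  ∃ (A B : Finset V) (f : Finset V → Finset V),
    Disjoint A B ∧ A.card = 2 * k - 2 ∧ s + 1 ≤ B.card ∧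
    (∀ S ∈ A.powersetCard (k - 1), f S ∈ B.powersetCard (s + 1) ∧ f S = f (A \ S)) ∧
    F = doubleStarFamily k A f

/-!
Write `k = n + 1`. If `R` is large, the edges disjoint from a given edge `A` contain a large
sunflower, whose kernel is disjoint from `A`. An edge disjoint from this kernel meets at most `k`
members of the sunflower, so double counting shows that the kernel is *light*: it is disjoint from
barely more than `s` edges. Thus every edge is disjoint from a light set of at most `n` vertices.

A minimal family of light sets with this property forms a set-pair system with the edges witnessing
minimality, so its size is bounded in terms of `k`. Replacing the edges by their traces on the union
of this family loses only the boundedly many edges contained in the union, and gives a set-pair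
system of sets of size at most `n`. By Bollobás it has at most `C(2n, n)` members, and equality
holds, since otherwise the light sets would account for too few of the `s * C(2n, n)` edges. The
uniqueness part of Bollobás's theorem then shows that the light sets of this system are the
`n`-subsets of a set `W` of size `2n`.

By the same count, every `n`-subset of `W` is the trace of roughly `3s/4` or more edges. An edge
meeting `W` in fewer than `n` points would miss two such subsets, hence be disjoint from about
`3s/2` edges, which is too many. So every edge has at least `n` points in `W`, and exactly `n` since
it is disjoint from another edge; that is, `F` is the family `M_f` with `f` given by the links of
the `n`-subsets of `W`.
-/

section SetPairSystems

open Finset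

variable {ι α : Type*} {I : Finset ι} {T X : ι → Finset α}

/-- A (Bollobás) set-pair system: the pairs `(T i, X i)`, `i ∈ I`, are disjoint, while `T i` meets
`X j` for all distinct `i` and `j`. -/
def IsSetPairSystem (I : Finset ι) (T X : ι → Finset α) : Prop :=
  ∀ ⦃i⦄, i ∈ I → ∀ ⦃j⦄, j ∈ I → (Disjoint (T i) (X j) ↔ i = j)

/-- The left-hand side `∑ 1 / C(|T i| + |X i|, |T i|)` of Bollobás's set-pair inequality. -/
def setPairWeight (I : Finset ι) (T X : ι → Finset α) : ℚ :=
  ∑ i ∈ I, ((#(T i) + #(X i)).choose #(T i) : ℚ)⁻¹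

theorem IsSetPairSystem.symm (h : IsSetPairSystem I T X) : IsSetPairSystem I X T :=
  fun i hi j hj => by rw [disjoint_comm, h hj hi, eq_comm]

theorem setPairWeight_comm (I : Finset ι) (T X : ι → Finset α) :
    setPairWeight I T X = setPairWeight I X T :=
  sum_congr rfl fun i _ => by rw [Nat.choose_symm_add, add_comm]

theorem IsSetPairSystem.setPairWeight_eq_one_of_eq_empty (h : IsSetPairSystem I T X) {i : ι}
    (hi : i ∈ I) (hXi : X i = ∅) : setPairWeight I T X = 1 := by
  have hI : I = {i} := eq_singleton_iff_unique_mem.2 ⟨hi, fun j hj =>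
    (h hj hi).1 (hXi ▸ disjoint_empty_right _)⟩
  simp [setPairWeight, hI, hXi]

theorem exists_common_superset (I : Finset ι) (T X : ι → Finset α) :
    ∃ Y : Finset α, ∀ i ∈ I, T i ⊆ Y ∧ X i ⊆ Y := by
  classical
  exact ⟨I.biUnion fun i => T i ∪ X i, fun i hi =>
    union_subset_iff.1 (subset_biUnion_of_mem (fun i => T i ∪ X i) hi)⟩

theorem inv_choose_mul_succ (a b : ℕ) :
    (b + 1 : ℚ) * ((a + b).choose a : ℚ)⁻¹ =
      (a + b + 1 : ℚ) * ((a + b + 1).choose a : ℚ)⁻¹ := by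
  have hchoose : ((a + b).choose a : ℚ) * (a + b + 1) = (a + b + 1).choose a * (b + 1) := by
    have h := Nat.choose_mul_succ_eq (a + b) a
    rw [show a + b + 1 - a = b + 1 by omega] at h
    exact_mod_cast h
  have hpos : ((a + b).choose a : ℚ) ≠ 0 := mod_cast (Nat.choose_pos (by omega)).ne'
  have hpos' : ((a + b + 1).choose a : ℚ) ≠ 0 := mod_cast (Nat.choose_pos (by omega)).ne'
  field_simp
  linarith

theorem choose_lt_centralBinom {a m n : ℕ} (h : m < 2 * n) : m.choose a < n.centralBinom := by
  obtain ⟨n, rfl⟩ : ∃ l, n = l + 1 := ⟨n - 1, by omega⟩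
  calc m.choose a ≤ (2 * n + 1).choose a := Nat.choose_le_choose a (by omega)
    _ ≤ (2 * n + 1).choose n := by
      simpa [show (2 * n + 1) / 2 = n by omega] using Nat.choose_le_middle a (2 * n + 1)
    _ < (2 * n + 1).choose n + (2 * n + 1).choose (n + 1) :=
      Nat.lt_add_of_pos_right (Nat.choose_pos (by omega))
    _ = (n + 1).centralBinom := rfl

theorem choose_le_centralBinom_of_le {a m n : ℕ} (h : m ≤ 2 * n) :
    m.choose a ≤ n.centralBinom :=
  (Nat.choose_le_choose a h).trans (Nat.choose_le_centralBinom a n)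

theorem inv_centralBinom_le_inv_choose {a b n : ℕ} (h : a + b ≤ 2 * n) :
    (n.centralBinom : ℚ)⁻¹ ≤ ((a + b).choose a : ℚ)⁻¹ :=
  inv_anti₀ (mod_cast Nat.choose_pos (Nat.le_add_right a b))
    (mod_cast choose_le_centralBinom_of_le h)

section Deletion

variable [DecidableEq α]

theorem IsSetPairSystem.delete (h : IsSetPairSystem I T X) (P : Finset α) :
    IsSetPairSystem {i ∈ I | Disjoint (T i) P} T (X · \ P) := by
  intro i hi j hj
  rw [mem_filter] at hi hj
  change Disjoint (T i) (X j \ P) ↔ i = j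
  rw [← h hi.1 hj.1]
  conv_rhs => rw [← sdiff_union_inter (X j) P, disjoint_union_right,
    and_iff_left (hi.2.mono_right inter_subset_right)]

theorem setPairWeight_delete_insert (I : Finset ι) (T X : ι → Finset α) (y : α) (P : Finset α) :
    setPairWeight {i ∈ I | Disjoint (T i) (insert y P)} T (X · \ insert y P) =
      setPairWeight {i ∈ {i ∈ I | Disjoint (T i) P} | Disjoint (T i) {y}} T
        (fun i => (X i \ P) \ {y}) := by
  simp only [insert_eq, union_comm {y} P, disjoint_union_right, filter_filter, sdiff_sdiff_left,
    sup_eq_union]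

theorem sum_inv_choose_sdiff_singleton {Y T X : Finset α} (hT : T ⊆ Y) (hX : X ⊆ Y)
    (hTX : Disjoint T X) (hne : X.Nonempty) :
    ∑ y ∈ Y \ T, ((#T + #(X \ {y})).choose #T : ℚ)⁻¹ = #Y * ((#T + #X).choose #T : ℚ)⁻¹ := by
  obtain ⟨b, hb⟩ : ∃ b, #X = b + 1 := ⟨#X - 1, by have := hne.card_pos; omega⟩
  have hXY : X ⊆ Y \ T := subset_sdiff.2 ⟨hX, hTX.symm⟩
  have houtside : ∑ y ∈ (Y \ T) \ X, ((#T + #(X \ {y})).choose #T : ℚ)⁻¹ =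
      #((Y \ T) \ X) * ((#T + #X).choose #T : ℚ)⁻¹ := by
    rw [← nsmul_eq_mul]
    refine sum_eq_card_nsmul fun y hy => ?_
    rw [sdiff_singleton_eq_erase, erase_eq_of_notMem (mem_sdiff.1 hy).2]
  have hinside : ∑ y ∈ X, ((#T + #(X \ {y})).choose #T : ℚ)⁻¹ =
      #X * ((#T + b).choose #T : ℚ)⁻¹ := by
    rw [← nsmul_eq_mul]
    refine sum_eq_card_nsmul fun y hy => ?_
    rw [sdiff_singleton_eq_erase, card_erase_of_mem hy, hb, Nat.add_sub_cancel]
  have hcard : #((Y \ T) \ X) + (#T + #X) = #Y := by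
    have := card_sdiff_add_card_eq_card hXY
    have := card_sdiff_add_card_eq_card hT
    omega
  rw [← sum_sdiff hXY, houtside, hinside, ← hcard, hb]
  push_cast
  rw [inv_choose_mul_succ, ← add_assoc #T b 1]
  ring

theorem IsSetPairSystem.sum_setPairWeight_delete (h : IsSetPairSystem I T X) {Y : Finset α}
    (hY : ∀ i ∈ I, T i ⊆ Y ∧ X i ⊆ Y) (hne : ∀ i ∈ I, (X i).Nonempty) :
    ∑ y ∈ Y, setPairWeight {i ∈ I | Disjoint (T i) {y}} T (X · \ {y}) =
      #Y * setPairWeight I T X := by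
  simp only [setPairWeight, sum_filter, mul_sum, disjoint_singleton_right]
  rw [sum_comm]
  refine sum_congr rfl fun i hi => ?_
  rw [← sum_filter, ← sdiff_eq_filter]
  exact sum_inv_choose_sdiff_singleton (hY i hi).1 (hY i hi).2 ((h hi hi).2 rfl) (hne i hi)

end Deletion

theorem IsSetPairSystem.setPairWeight_le_one (h : IsSetPairSystem I T X) :
    setPairWeight I T X ≤ 1 := by
  classical
  obtain ⟨Y, hY⟩ := exists_common_superset I T X
  induction Y using Finset.strongInduction generalizing I X with
  | H Y ih =>
    by_cases! hne : ∃ i ∈ I, X i = ∅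
    · obtain ⟨i, hi, hXi⟩ := hne
      exact (h.setPairWeight_eq_one_of_eq_empty hi hXi).le
    obtain rfl | ⟨i, hi⟩ := I.eq_empty_or_nonempty
    · simp [setPairWeight]
    have hYpos : (0 : ℚ) < #Y := mod_cast ((hne i hi).mono (hY i hi).2).card_pos
    refine le_of_mul_le_mul_left ?_ hYpos
    rw [← h.sum_setPairWeight_delete hY hne, ← nsmul_eq_mul]
    refine sum_le_card_nsmul _ _ _ fun y hy => ih _ (erase_ssubset hy) (h.delete {y}) ?_
    intro i hi
    rw [mem_filter, disjoint_singleton_right] at hi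
    rw [sdiff_singleton_eq_erase]
    exact ⟨subset_erase.2 ⟨(hY i hi.1).1, hi.2⟩, erase_subset_erase _ (hY i hi.1).2⟩

theorem IsSetPairSystem.card_le (h : IsSetPairSystem I T X) {n : ℕ}
    (hcard : ∀ i ∈ I, #(T i) + #(X i) ≤ 2 * n) : #I ≤ n.centralBinom := by
  have hpos : (0 : ℚ) < n.centralBinom := mod_cast n.centralBinom_pos
  have hsum : #I • (n.centralBinom : ℚ)⁻¹ ≤ 1 :=
    (card_nsmul_le_sum I _ _ fun i hi => inv_centralBinom_le_inv_choose (hcard i hi)).trans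
      h.setPairWeight_le_one
  rw [nsmul_eq_mul, ← div_eq_mul_inv, div_le_one hpos] at hsum
  exact_mod_cast hsum

theorem IsSetPairSystem.setPairWeight_eq_one (h : IsSetPairSystem I T X) {n : ℕ}
    (hcard : ∀ i ∈ I, #(T i) + #(X i) ≤ 2 * n) (hI : #I = n.centralBinom) :
    setPairWeight I T X = 1 ∧ ∀ i ∈ I, #(T i) + #(X i) = 2 * n := by
  have hle : ∀ i ∈ I, (n.centralBinom : ℚ)⁻¹ ≤ ((#(T i) + #(X i)).choose #(T i) : ℚ)⁻¹ :=
    fun i hi => inv_centralBinom_le_inv_choose (hcard i hi)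
  have hconst : ∑ _i ∈ I, (n.centralBinom : ℚ)⁻¹ = 1 := by
    rw [sum_const, hI, nsmul_eq_mul, mul_inv_cancel₀ (mod_cast n.centralBinom_ne_zero)]
  have hw : setPairWeight I T X = 1 :=
    h.setPairWeight_le_one.antisymm (hconst ▸ sum_le_sum hle)
  refine ⟨hw, fun i hi => (hcard i hi).eq_of_not_lt fun hlt => ?_⟩
  have heq := (sum_eq_sum_iff_of_le hle).1 (hconst.trans hw.symm) i hi
  rw [inv_inj, Nat.cast_inj] at heq
  exact (choose_lt_centralBinom hlt).ne' heq

variable [DecidableEq α]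

theorem IsSetPairSystem.setPairWeight_delete_singleton_eq_one (h : IsSetPairSystem I T X)
    (hw : setPairWeight I T X = 1) (hne : ∀ i ∈ I, (X i).Nonempty) (y : α) :
    setPairWeight {i ∈ I | Disjoint (T i) {y}} T (X · \ {y}) = 1 := by
  obtain ⟨Y, hY⟩ := exists_common_superset I T X
  have hY' : ∀ i ∈ I, T i ⊆ insert y Y ∧ X i ⊆ insert y Y := fun i hi =>
    ⟨(hY i hi).1.trans (subset_insert y Y), (hY i hi).2.trans (subset_insert y Y)⟩
  refine (sum_eq_sum_iff_of_le fun z _ => (h.delete {z}).setPairWeight_le_one).1 ?_ y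
    (mem_insert_self y Y)
  rw [h.sum_setPairWeight_delete hY' hne, hw, mul_one, sum_const, nsmul_one]

theorem IsSetPairSystem.setPairWeight_delete_eq_one (h : IsSetPairSystem I T X)
    (hw : setPairWeight I T X = 1) (P : Finset α) (hP : ∀ i ∈ I, #P ≤ #(X i)) :
    setPairWeight {i ∈ I | Disjoint (T i) P} T (X · \ P) = 1 := by
  induction P using Finset.induction_on with
  | empty => simpa using hw
  | insert y P hy ih =>
    simp only [card_insert_of_notMem hy] at hP
    rw [setPairWeight_delete_insert]
    refine (h.delete P).setPairWeight_delete_singleton_eq_one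
      (ih fun i hi => (Nat.le_succ _).trans (hP i hi)) (fun i hi => ?_) y
    rw [sdiff_nonempty]
    exact fun hsub => (card_le_card hsub).not_gt (hP i (mem_filter.1 hi).1)

/-- Deleting `X i - x + t` keeps the weight equal to `1`. If this set were no `X j`, deleting `x` as
well would still keep it, although no pair survives that deletion. -/
theorem IsSetPairSystem.exists_eq_insert_erase (h : IsSetPairSystem I T X)
    (hw : setPairWeight I T X = 1) {n : ℕ} (hX : ∀ i ∈ I, #(X i) = n) {i : ι} (hi : i ∈ I)
    {t x : α} (ht : t ∈ T i) (hx : x ∈ X i) : ∃ j ∈ I, X j = insert t ((X i).erase x) := by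
  by_contra! hno
  set P := insert t ((X i).erase x) with hP
  have htX : t ∉ X i := disjoint_left.1 ((h hi hi).2 rfl) ht
  have hPcard : #P = n := by
    rw [hP, card_insert_of_notMem (fun ht' => htX (mem_of_mem_erase ht')),
      card_erase_add_one hx, hX i hi]
  have hwP := h.setPairWeight_delete_eq_one hw P fun j hj => (hPcard.trans (hX j hj).symm).le
  have hwPx := (h.delete P).setPairWeight_delete_singleton_eq_one hwP (fun j hj => by
    rw [sdiff_nonempty]
    exact fun hsub => hno j (mem_filter.1 hj).1 (eq_of_subset_of_card_le hsub
      (hPcard.trans (hX j (mem_filter.1 hj).1).symm).le)) x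
  have hnone : {j ∈ I | Disjoint (T j) (insert x P)} = ∅ := by
    refine filter_false_of_mem fun j hj hd => ?_
    have hXi : X i ⊆ insert x P := by
      rw [hP, insert_comm, insert_erase hx]
      exact subset_insert t (X i)
    obtain rfl : j = i := (h hj hi).1 (hd.mono_right hXi)
    exact disjoint_left.1 hd ht (mem_insert_of_mem (mem_insert_self t _))
  rw [← setPairWeight_delete_insert, hnone] at hwPx
  exact zero_ne_one hwPx

theorem IsSetPairSystem.exists_exchange (h : IsSetPairSystem I T X)
    (hw : setPairWeight I T X = 1) {n : ℕ} (hcard : ∀ i ∈ I, #(T i) = n ∧ #(X i) = n)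
    {i : ι} (hi : i ∈ I) {t x : α} (ht : t ∈ T i) (hx : x ∈ X i) :
    ∃ j ∈ I, T j = insert x ((T i).erase t) ∧ X j = insert t ((X i).erase x) := by
  obtain ⟨j, hj, hXj⟩ := h.exists_eq_insert_erase hw (fun i hi => (hcard i hi).2) hi ht hx
  obtain ⟨j', hj', hTj'⟩ := h.symm.exists_eq_insert_erase (setPairWeight_comm I T X ▸ hw)
    (fun i hi => (hcard i hi).1) hi hx ht
  have hd : Disjoint (T i) (X i) := (h hi hi).2 rfl
  obtain rfl : j' = j := (h hj' hj).1 <| by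
    rw [hTj', hXj, disjoint_left]
    rw [disjoint_left] at hd
    grind
  exact ⟨j', hj, hTj', hXj⟩

theorem forall_powersetCard_of_exchange {n : ℕ} {W S₀ : Finset α} {p : Finset α → Prop}
    (hS₀ : S₀ ∈ W.powersetCard n) (hp : p S₀)
    (hexchange : ∀ S, p S → ∀ t ∈ S, ∀ x ∈ W \ S, p (insert x (S.erase t))) :
    ∀ S ∈ W.powersetCard n, p S := by
  intro S hS
  induction hm : #(S \ S₀) generalizing S with
  | zero =>
    rw [card_eq_zero, sdiff_eq_empty_iff_subset] at hm
    rw [mem_powersetCard] at hS hS₀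
    rwa [eq_of_subset_of_card_le hm (hS₀.2.trans hS.2.symm).le]
  | succ m ih =>
    rw [mem_powersetCard] at hS
    have hcard : #(S₀ \ S) = #(S \ S₀) :=
      card_sdiff_comm ((mem_powersetCard.1 hS₀).2.trans hS.2.symm)
    obtain ⟨x, hx⟩ := card_pos.1 (by omega : 0 < #(S \ S₀))
    obtain ⟨t, ht⟩ := card_pos.1 (by omega : 0 < #(S₀ \ S))
    have hx' := mem_sdiff.1 hx
    have ht' := mem_sdiff.1 ht
    have htS : t ∉ S.erase x := fun h => ht'.2 (mem_of_mem_erase h)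
    have hcloser : p (insert t (S.erase x)) := by
      refine ih _ (mem_powersetCard.2 ⟨insert_subset ((mem_powersetCard.1 hS₀).1 ht'.1)
        ((erase_subset x S).trans hS.1), ?_⟩) ?_
      · rw [card_insert_of_notMem htS, card_erase_add_one hx'.1, hS.2]
      · rw [insert_sdiff_of_mem _ ht'.1, erase_sdiff_comm, card_erase_of_mem hx, hm,
          Nat.add_sub_cancel]
    have htx : x ≠ t := by rintro rfl; exact ht'.2 hx'.1
    have := hexchange _ hcloser t (mem_insert_self _ _) x
      (mem_sdiff.2 ⟨hS.1 hx'.1, by simp [htx]⟩)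
    rwa [erase_insert htS, insert_erase hx'.1] at this

/-- Uniqueness in Bollobás's theorem. -/
theorem IsSetPairSystem.exists_image_eq_powersetCard (h : IsSetPairSystem I T X) {n : ℕ}
    (hT : ∀ i ∈ I, #(T i) ≤ n) (hX : ∀ i ∈ I, #(X i) ≤ n) (hI : #I = n.centralBinom) :
    ∃ W : Finset α, #W = 2 * n ∧ I.image T = W.powersetCard n := by
  obtain ⟨hw, hsum⟩ := h.setPairWeight_eq_one
    (fun i hi => by linarith [hT i hi, hX i hi]) hI
  have hcard : ∀ i ∈ I, #(T i) = n ∧ #(X i) = n := fun i hi => by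
    have := hT i hi; have := hX i hi; have := hsum i hi; omega
  obtain ⟨i₀, hi₀⟩ := card_pos.1 (hI ▸ n.centralBinom_pos)
  have hd₀ : Disjoint (T i₀) (X i₀) := (h hi₀ hi₀).2 rfl
  have hW : #(T i₀ ∪ X i₀) = 2 * n := by rw [card_union_of_disjoint hd₀, hsum i₀ hi₀]
  refine ⟨T i₀ ∪ X i₀, hW, (eq_of_subset_of_card_le (fun S hS => ?_) ?_).symm⟩
  · have hall := forall_powersetCard_of_exchange
      (p := fun S => S ⊆ T i₀ ∪ X i₀ ∧ ∃ j ∈ I, T j = S ∧ X j = (T i₀ ∪ X i₀) \ S)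
      (mem_powersetCard.2 ⟨subset_union_left, (hcard i₀ hi₀).1⟩)
      ⟨subset_union_left, i₀, hi₀, rfl, (union_sdiff_cancel_left hd₀).symm⟩ ?_ S hS
    · obtain ⟨-, j, hj, hTj, -⟩ := hall
      exact mem_image.2 ⟨j, hj, hTj⟩
    · rintro _ ⟨hsub, j, hj, rfl, hXj⟩ t ht x hx
      obtain ⟨j', hj', hTj', hXj'⟩ := h.exists_exchange hw hcard hj ht (hXj ▸ hx)
      refine ⟨insert_subset (mem_sdiff.1 hx).1 ((erase_subset t _).trans hsub), j', hj', hTj', ?_⟩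
      rw [hXj', hXj]
      grind
  · rw [card_powersetCard, hW, ← Nat.centralBinom_eq_two_mul_choose, ← hI]
    exact card_image_le

end SetPairSystems

section Sunflowers

open Finset

variable {α : Type*} [DecidableEq α] {F G 𝒮 𝒮' : Finset (Finset α)} {T : Finset α}
  {k m p r s : ℕ}

/-- `𝒮` is a sunflower with kernel `T`: its members contain `T` and the petals `B \ T` are pairwise
disjoint. -/
def IsSunflower (𝒮 : Finset (Finset α)) (T : Finset α) : Prop :=
  (∀ B ∈ 𝒮, T ⊆ B) ∧ (𝒮 : Set (Finset α)).PairwiseDisjoint (· \ T)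

theorem IsSunflower.subset (h : IsSunflower 𝒮 T) (h𝒮 : 𝒮' ⊆ 𝒮) : IsSunflower 𝒮' T :=
  ⟨fun B hB => h.1 B (h𝒮 hB), h.2.subset (coe_subset.2 h𝒮)⟩

theorem IsSunflower.insert (h : IsSunflower 𝒮 T) {A : Finset α} (hTA : T ⊆ A)
    (hA : Disjoint (A \ T) (𝒮.biUnion id)) : IsSunflower (insert A 𝒮) T := by
  refine ⟨forall_mem_insert _ _ _ |>.2 ⟨hTA, h.1⟩, ?_⟩
  rw [coe_insert]
  exact h.2.insert fun B hB _ =>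
    hA.mono_right (sdiff_subset.trans (subset_biUnion_of_mem id hB))

theorem exists_isSunflower_forall_not_disjoint (hG : (G : Set (Finset α)).Sized k)
    (hT : #T < k) :
    ∃ 𝒮 ⊆ G, IsSunflower 𝒮 T ∧ ∀ A ∈ G, T ⊆ A → ¬ Disjoint (A \ T) (𝒮.biUnion id) := by
  classical
  obtain ⟨𝒮, h𝒮⟩ := {𝒮 ∈ G.powerset | IsSunflower 𝒮 T}.exists_maximal
    ⟨∅, mem_filter.2 ⟨empty_mem_powerset G, by simp [IsSunflower]⟩⟩
  obtain ⟨h𝒮G, hsun⟩ := mem_filter.1 h𝒮.prop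
  rw [mem_powerset] at h𝒮G
  refine ⟨𝒮, h𝒮G, hsun, fun A hA hTA hd => ?_⟩
  have hA𝒮 : A ∈ 𝒮 := h𝒮.le_of_ge (mem_filter.2 ⟨mem_powerset.2 (insert_subset hA h𝒮G),
    hsun.insert hTA hd⟩) (subset_insert A 𝒮) (mem_insert_self A 𝒮)
  have hAT : A \ T = ∅ := disjoint_self_iff_empty _ |>.1 <|
    hd.mono_right (sdiff_subset.trans (subset_biUnion_of_mem id hA𝒮))
  exact hT.not_ge (hG hA ▸ card_le_card (sdiff_eq_empty_iff_subset.1 hAT))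

theorem exists_lt_card_filter_insert_subset {Z : Finset α}
    (hZ : ∀ A ∈ G, T ⊆ A → ¬ Disjoint (A \ T) Z) (h : #Z * r < #{A ∈ G | T ⊆ A}) :
    ∃ z ∉ T, r < #{A ∈ G | insert z T ⊆ A} := by
  by_contra! hle
  have hsub : {A ∈ G | T ⊆ A} ⊆ (Z \ T).biUnion fun z => {A ∈ G | insert z T ⊆ A} := by
    intro A hA
    obtain ⟨hAG, hTA⟩ := mem_filter.1 hA
    obtain ⟨z, hzA, hzZ⟩ := not_disjoint_iff.1 (hZ A hAG hTA)
    obtain ⟨hzA, hzT⟩ := mem_sdiff.1 hzA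
    exact mem_biUnion.2 ⟨z, mem_sdiff.2 ⟨hzZ, hzT⟩,
      mem_filter.2 ⟨hAG, insert_subset hzA hTA⟩⟩
  refine h.not_ge ?_
  calc #{A ∈ G | T ⊆ A} ≤ #(Z \ T) * r := (card_le_card hsub).trans <|
        card_biUnion_le_card_mul _ _ _ fun z hz => hle z (mem_sdiff.1 hz).2
    _ ≤ #Z * r := Nat.mul_le_mul_right r (card_le_card sdiff_subset)

/-- The Erdős–Rado sunflower lemma, with an initial set `T` that grows during the induction. -/
theorem exists_isSunflower (hG : (G : Set (Finset α)).Sized k) (hT : #T + m = k)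
    (h : (p * k) ^ m < #{A ∈ G | T ⊆ A}) :
    ∃ 𝒮 ⊆ G, ∃ T', #T' < k ∧ #𝒮 = p ∧ IsSunflower 𝒮 T' := by
  induction m generalizing T with
  | zero =>
    have hsub : {A ∈ G | T ⊆ A} ⊆ {T} := fun A hA => by
      obtain ⟨hAG, hTA⟩ := mem_filter.1 hA
      exact mem_singleton.2 (eq_of_subset_of_card_le hTA (hG hAG ▸ hT.ge)).symm
    exact absurd (card_le_card hsub) h.not_ge
  | succ m ih =>
    have hTk : #T < k := by omega
    obtain ⟨𝒮, h𝒮G, hsun, hmeet⟩ := exists_isSunflower_forall_not_disjoint hG hTk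
    obtain hp | hp := le_or_gt p #𝒮
    · obtain ⟨𝒮', h𝒮', hcard⟩ := exists_subset_card_eq hp
      exact ⟨𝒮', h𝒮'.trans h𝒮G, T, hTk, hcard, hsun.subset h𝒮'⟩
    have hZ : #(𝒮.biUnion id) ≤ p * k :=
      (card_biUnion_le_card_mul _ _ k fun B hB => (hG (h𝒮G hB)).le).trans
        (Nat.mul_le_mul_right k hp.le)
    obtain ⟨z, hzT, hz⟩ := exists_lt_card_filter_insert_subset (r := (p * k) ^ m) hmeet
      ((Nat.mul_le_mul_right _ hZ).trans_lt (pow_succ' (p * k) m ▸ h))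
    exact ih (by rw [card_insert_of_notMem hzT]; omega) hz

theorem IsSunflower.card_filter_not_disjoint_le (h : IsSunflower 𝒮 T) {A : Finset α}
    (hA : Disjoint A T) : #{B ∈ 𝒮 | ¬ Disjoint A B} ≤ #A := by
  refine card_le_card_of_forall_subsingleton (fun B z => z ∈ B)
    (fun B hB => not_disjoint_iff.1 (mem_filter.1 hB).2) ?_
  rintro z hz B ⟨hB, hzB⟩ B' ⟨hB', hzB'⟩
  have hzT : z ∉ T := disjoint_left.1 hA hz
  exact h.2.elim_finset (mem_filter.1 hB).1 (mem_filter.1 hB').1 z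
    (mem_sdiff.2 ⟨hzB, hzT⟩) (mem_sdiff.2 ⟨hzB', hzT⟩)

/-- The edges of `F` disjoint from `T`. -/
def disjointEdges (F : Finset (Finset α)) (T : Finset α) : Finset (Finset α) :=
  {B ∈ F | Disjoint B T}

theorem mem_disjointEdges {B : Finset α} : B ∈ disjointEdges F T ↔ B ∈ F ∧ Disjoint B T :=
  mem_filter

theorem IsSunflower.card_disjointEdges_mul_le (h : IsSunflower 𝒮 T)
    (hF : (F : Set (Finset α)).Sized k) (hs : ∀ A ∈ 𝒮, #(disjointEdges F A) ≤ s) :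
    #(disjointEdges F T) * (#𝒮 - k) ≤ #𝒮 * s := by
  refine card_mul_le_card_mul Disjoint (fun A hA => ?_) fun B hB => ?_
  · obtain ⟨hAF, hAT⟩ := mem_disjointEdges.1 hA
    have hmeet := h.card_filter_not_disjoint_le hAT
    rw [hF hAF] at hmeet
    have := card_filter_add_card_filter_not (s := 𝒮) (Disjoint A ·)
    rw [bipartiteAbove]
    omega
  · refine (card_le_card fun A hA => ?_).trans (hs B hB)
    obtain ⟨hA, hAB⟩ := mem_bipartiteBelow _ |>.1 hA
    exact mem_disjointEdges.2 ⟨(mem_disjointEdges.1 hA).1, hAB⟩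

end Sunflowers

section LightSets

open Finset

variable {α : Type*} [DecidableEq α] {F 𝒮 𝒯 : Finset (Finset α)} {A T : Finset α} {N k s : ℕ}

/-- `T` is light: it is disjoint from at most `(1 + 1 / (4 * N)) * s` edges of `F`. -/
def IsLight (N s : ℕ) (F : Finset (Finset α)) (T : Finset α) : Prop :=
  4 * N * #(disjointEdges F T) ≤ (4 * N + 1) * s

theorem IsSunflower.isLight (h : IsSunflower 𝒮 T) (hF : (F : Set (Finset α)).Sized k)
    (hs : ∀ A ∈ 𝒮, #(disjointEdges F A) ≤ s) (hk : 0 < k) (h𝒮 : #𝒮 = (4 * N + 1) * k) :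
    IsLight N s F T := by
  have hmul := h.card_disjointEdges_mul_le hF hs
  rw [h𝒮, show (4 * N + 1) * k - k = 4 * N * k by rw [add_one_mul, Nat.add_sub_cancel]] at hmul
  exact Nat.le_of_mul_le_mul_left (by linarith) hk

theorem exists_isLight_disjoint (hF : (F : Set (Finset α)).Sized k)
    (hs : ∀ B ∈ F, #(disjointEdges F B) ≤ s)
    (hA : ((4 * N + 1) * k * k) ^ k < #(disjointEdges F A)) :
    ∃ T, #T < k ∧ IsLight N s F T ∧ Disjoint A T := by
  have hsized : (disjointEdges F A : Set (Finset α)).Sized k :=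
    fun B hB => hF (mem_disjointEdges.1 hB).1
  obtain ⟨𝒮, h𝒮, T, hT, hcard, hsun⟩ := exists_isSunflower hsized (T := ∅) (m := k)
    (by simp) (by simpa using hA)
  have hk : 0 < k := hT.pos
  obtain ⟨B, hB⟩ : 𝒮.Nonempty := card_pos.1 (hcard ▸ by positivity)
  refine ⟨T, hT, hsun.isLight hF (fun C hC => hs C (mem_disjointEdges.1 (h𝒮 hC)).1) hk hcard, ?_⟩
  exact (mem_disjointEdges.1 (h𝒮 hB)).2.symm.mono_right (hsun.1 B hB)

/-- The edges of `F` that meet every member of `𝒯`. -/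
def hittingEdges (F 𝒯 : Finset (Finset α)) : Finset (Finset α) :=
  {A ∈ F | ∀ T ∈ 𝒯, ¬ Disjoint A T}

theorem mem_hittingEdges : A ∈ hittingEdges F 𝒯 ↔ A ∈ F ∧ ∀ T ∈ 𝒯, ¬ Disjoint A T :=
  mem_filter

theorem hittingEdges_eq_empty : hittingEdges F 𝒯 = ∅ ↔ ∀ A ∈ F, ∃ T ∈ 𝒯, Disjoint A T := by
  simp [hittingEdges, filter_eq_empty_iff]

theorem card_le_card_hittingEdges_add_sum (F 𝒯 : Finset (Finset α)) :
    #F ≤ #(hittingEdges F 𝒯) + ∑ T ∈ 𝒯, #(disjointEdges F T) := by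
  have hsub : F ⊆ hittingEdges F 𝒯 ∪ 𝒯.biUnion (disjointEdges F) := by
    intro A hA
    by_cases hd : ∃ T ∈ 𝒯, Disjoint A T
    · obtain ⟨T, hT, hd⟩ := hd
      exact mem_union_right _ (mem_biUnion.2 ⟨T, hT, mem_disjointEdges.2 ⟨hA, hd⟩⟩)
    · push Not at hd
      exact mem_union_left _ (mem_hittingEdges.2 ⟨hA, hd⟩)
  exact (card_le_card hsub).trans <| (card_union_le _ _).trans <|
    Nat.add_le_add_left card_biUnion_le _

theorem three_mul_le_four_mul_card_hittingEdges (h𝒯 : ∀ T ∈ 𝒯, IsLight N s F T) (hN : #𝒯 < N)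
    (hF : N * s ≤ #F) : 3 * s ≤ 4 * #(hittingEdges F 𝒯) := by
  have hsum : 4 * N * ∑ T ∈ 𝒯, #(disjointEdges F T) ≤ #𝒯 * ((4 * N + 1) * s) := by
    rw [mul_sum]
    exact sum_le_card_nsmul _ _ _ h𝒯
  have hcount := card_le_card_hittingEdges_add_sum F 𝒯
  obtain ⟨m, rfl⟩ := Nat.exists_eq_add_of_lt hN
  refine le_of_mul_le_mul_left ?_ (show 0 < #𝒯 + m + 1 by omega)
  nlinarith [Nat.zero_le (m * s), Nat.zero_le (#𝒯 * s)]

theorem exists_isSetPairSystem_of_hittingEdges_eq_empty (h : hittingEdges F 𝒯 = ∅) :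
    ∃ 𝒯' ⊆ 𝒯, hittingEdges F 𝒯' = ∅ ∧
      ∃ X : Finset α → Finset α, (∀ T ∈ 𝒯', X T ∈ F) ∧ IsSetPairSystem 𝒯' id X := by
  obtain ⟨𝒯', hsub, hmin⟩ := exists_minimal_le_of_wellFoundedLT (hittingEdges F · = ∅) 𝒯 h
  have hcov := hittingEdges_eq_empty.1 hmin.prop
  have hX : ∀ T ∈ 𝒯', ∃ A ∈ F, ∀ T' ∈ 𝒯', Disjoint A T' ↔ T' = T := by
    intro T hT
    have hne := hmin.not_prop_of_lt (erase_ssubset hT)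
    rw [hittingEdges_eq_empty] at hne
    push Not at hne
    obtain ⟨A, hA, hmeet⟩ := hne
    have huniq : ∀ T' ∈ 𝒯', Disjoint A T' → T' = T := fun T' hT' hd => by
      by_contra hne
      exact hmeet T' (mem_erase.2 ⟨hne, hT'⟩) hd
    obtain ⟨T', hT', hd⟩ := hcov A hA
    exact ⟨A, hA, fun T'' hT'' => ⟨huniq T'' hT'', fun heq => heq ▸ huniq T' hT' hd ▸ hd⟩⟩
  choose! X hXF hX using hX
  exact ⟨𝒯', hsub, hmin.prop, X, hXF, fun T hT T' hT' => disjoint_comm.trans (hX T' hT' T hT)⟩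

theorem exists_light_cover (hF : (F : Set (Finset α)).Sized k)
    (hs : ∀ A ∈ F, #(disjointEdges F A) ≤ s)
    (hlarge : ∀ A ∈ F, ((4 * N + 1) * k * k) ^ k < #(disjointEdges F A)) :
    ∃ 𝒯 : Finset (Finset α), #𝒯 ≤ k.centralBinom ∧ (∀ T ∈ 𝒯, #T < k ∧ IsLight N s F T) ∧
      hittingEdges F 𝒯 = ∅ := by
  choose! T hTk hT hd using fun A hA => exists_isLight_disjoint hF hs (hlarge A hA)
  obtain ⟨𝒯, h𝒯, hcov, X, hXF, hsys⟩ := exists_isSetPairSystem_of_hittingEdges_eq_empty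
    (hittingEdges_eq_empty.2 fun A hA => ⟨T A, mem_image_of_mem T hA, hd A hA⟩)
  have hlight : ∀ S ∈ 𝒯, #S < k ∧ IsLight N s F S := fun S hS => by
    obtain ⟨A, hA, rfl⟩ := mem_image.1 (h𝒯 hS)
    exact ⟨hTk A hA, hT A hA⟩
  refine ⟨𝒯, hsys.card_le fun S hS => ?_, hlight, hcov⟩
  rw [id, hF (hXF S hS), two_mul]
  exact Nat.add_le_add_right (hlight S hS).1.le k

/-- Each `X T` is the trace of an edge on the union of `𝒯`; the edges left uncovered are those equal
to their trace. -/
theorem exists_isSetPairSystem_ssubset (h : hittingEdges F 𝒯 = ∅) :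
    ∃ 𝒯' ⊆ 𝒯, hittingEdges F 𝒯' ⊆ (𝒯.biUnion id).powerset ∧
      ∃ X : Finset α → Finset α, (∀ T ∈ 𝒯', ∃ A ∈ F, X T ⊂ A) ∧ IsSetPairSystem 𝒯' id X := by
  set U := 𝒯.biUnion id with hU
  have htrace : ∀ A, ∀ T ∈ 𝒯, Disjoint (A ∩ U) T ↔ Disjoint A T := fun A T hT => by
    have hTU : T ⊆ U := subset_biUnion_of_mem id hT
    rw [disjoint_iff_inter_eq_empty, disjoint_iff_inter_eq_empty, inter_assoc,
      inter_eq_right.2 hTU]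
  rw [hittingEdges_eq_empty] at h
  obtain ⟨𝒯', hsub, hcov, X, hX, hsys⟩ := exists_isSetPairSystem_of_hittingEdges_eq_empty
    (F := {A ∈ F | ¬ A ⊆ U}.image (· ∩ U)) (𝒯 := 𝒯) <| hittingEdges_eq_empty.2 fun Y hY => by
      obtain ⟨A, hA, rfl⟩ := mem_image.1 hY
      obtain ⟨T, hT, hd⟩ := h A (mem_filter.1 hA).1
      exact ⟨T, hT, (htrace A T hT).2 hd⟩
  refine ⟨𝒯', hsub, fun A hA => ?_, X, fun T hT => ?_, hsys⟩
  · obtain ⟨hAF, hmeet⟩ := mem_hittingEdges.1 hA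
    rw [mem_powerset]
    by_contra hAU
    obtain ⟨T, hT, hd⟩ := hittingEdges_eq_empty.1 hcov (A ∩ U)
      (mem_image_of_mem _ (mem_filter.2 ⟨hAF, hAU⟩))
    exact hmeet T hT ((htrace A T (hsub hT)).1 hd)
  · obtain ⟨A, hA, hAX⟩ := mem_image.1 (hX T hT)
    obtain ⟨hAF, hAU⟩ := mem_filter.1 hA
    refine ⟨A, hAF, hAX ▸ inter_subset_left.ssubset_of_ne fun heq => hAU ?_⟩
    exact inter_eq_left.1 heq

end LightSets

section GroundSet

open Finset

variable {α : Type*} [DecidableEq α] {F : Finset (Finset α)} {A S T W : Finset α} {c n s : ℕ}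

/-- Edges disjoint from more than this many others, in an `(n + 1)`-uniform family, are disjoint
from a light set of at most `n` vertices. -/
def degreeThreshold (n : ℕ) : ℕ :=
  ((4 * n.centralBinom + 1) * (n + 1) * (n + 1)) ^ (n + 1)

/-- A bound for the number of exceptional edges: the number of subsets of a union of
`(n + 1).centralBinom` sets of size `n`. -/
def exceptionalBound (n : ℕ) : ℕ :=
  2 ^ ((n + 1).centralBinom * n)

theorem exists_ground_set (hF : (F : Set (Finset α)).Sized (n + 1))
    (hs : ∀ A ∈ F, #(disjointEdges F A) ≤ s)
    (hlarge : ∀ A ∈ F, degreeThreshold n < #(disjointEdges F A))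
    (hcard : n.centralBinom * s ≤ #F) (hc : 4 * exceptionalBound n < 3 * s) :
    ∃ W : Finset α, #W = 2 * n ∧ (∀ T ∈ W.powersetCard n, IsLight n.centralBinom s F T) ∧
      #(hittingEdges F (W.powersetCard n)) ≤ exceptionalBound n := by
  obtain ⟨𝒯, h𝒯card, h𝒯, hcov⟩ := exists_light_cover hF hs hlarge
  obtain ⟨𝒯', hsub, hexc, X, hX, hsys⟩ := exists_isSetPairSystem_ssubset hcov
  have hTcard : ∀ T ∈ 𝒯, #T ≤ n := fun T hT => Nat.le_of_lt_succ (h𝒯 T hT).1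
  have hXcard : ∀ T ∈ 𝒯', #(X T) ≤ n := fun T hT => by
    obtain ⟨A, hA, hXA⟩ := hX T hT
    exact Nat.le_of_lt_succ ((card_lt_card hXA).trans_eq (hF hA))
  have hexc_card : #(hittingEdges F 𝒯') ≤ exceptionalBound n := by
    refine (card_le_card hexc).trans ?_
    rw [card_powerset]
    exact Nat.pow_le_pow_right two_pos <|
      (card_biUnion_le_card_mul _ _ n hTcard).trans (Nat.mul_le_mul_right n h𝒯card)
  have hle : #𝒯' ≤ n.centralBinom := hsys.card_le fun T hT =>
    (add_le_add (hTcard T (hsub hT)) (hXcard T hT)).trans_eq (two_mul n).symm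
  have hcard' : #𝒯' = n.centralBinom := hle.eq_of_not_lt fun hlt => by
    have := three_mul_le_four_mul_card_hittingEdges (fun T hT => (h𝒯 T (hsub hT)).2) hlt hcard
    omega
  obtain ⟨W, hW, himage⟩ := hsys.exists_image_eq_powersetCard
    (fun T hT => hTcard T (hsub hT)) hXcard hcard'
  rw [image_id] at himage
  exact ⟨W, hW, himage ▸ fun T hT => (h𝒯 T (hsub hT)).2, himage ▸ hexc_card⟩

theorem sdiff_mem_powersetCard (hW : #W = 2 * n) (hS : S ∈ W.powersetCard n) :
    W \ S ∈ W.powersetCard n := by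
  rw [mem_powersetCard] at hS ⊢
  refine ⟨sdiff_subset, ?_⟩
  rw [card_sdiff_of_subset hS.1]
  omega

theorem one_lt_card_powersetCard {α : Type*} {U : Finset α} {n : ℕ} (hn : n ≠ 0) (hU : n < #U) :
    1 < #(U.powersetCard n) := by
  rw [card_powersetCard]
  calc 1 < n + 1 := by omega
    _ = (n + 1).choose n := (Nat.choose_succ_self_right n).symm
    _ ≤ (#U).choose n := Nat.choose_le_choose n hU

/-- The edges of `F` whose trace on `W` is `S`. -/
def edgesWithTrace (F : Finset (Finset α)) (W S : Finset α) : Finset (Finset α) :=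
  {A ∈ F | A ∩ W = S}

theorem mem_edgesWithTrace : A ∈ edgesWithTrace F W S ↔ A ∈ F ∧ A ∩ W = S :=
  mem_filter

theorem hittingEdges_erase_sdiff_subset (hW : #W = 2 * n) (hS : S ∈ W.powersetCard n) :
    hittingEdges F ((W.powersetCard n).erase (W \ S)) ⊆
      hittingEdges F (W.powersetCard n) ∪ edgesWithTrace F W S := by
  intro A hA
  obtain ⟨hAF, hmeet⟩ := mem_hittingEdges.1 hA
  by_cases hd : Disjoint A (W \ S)
  swap
  · refine mem_union_left _ (mem_hittingEdges.2 ⟨hAF, fun T hT => ?_⟩)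
    obtain rfl | hne := eq_or_ne T (W \ S)
    exacts [hd, hmeet T (mem_erase.2 ⟨hne, hT⟩)]
  have hsub : W \ S ⊆ W \ A := subset_sdiff.2 ⟨sdiff_subset, hd.symm⟩
  have hle : #(W \ A) ≤ n := by
    by_contra! hlt
    have := card_le_card (sdiff_subset (s := W) (t := A))
    obtain ⟨T, hT, hne⟩ := exists_mem_ne (one_lt_card_powersetCard (by omega) hlt) (W \ S)
    obtain ⟨hTsub, hTn⟩ := mem_powersetCard.1 hT
    obtain ⟨hTW, hTA⟩ := subset_sdiff.1 hTsub
    exact hmeet T (mem_erase.2 ⟨hne, mem_powersetCard.2 ⟨hTW, hTn⟩⟩) hTA.symm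
  have heq : W \ S = W \ A := eq_of_subset_of_card_le hsub <|
    hle.trans_eq (mem_powersetCard.1 (sdiff_mem_powersetCard hW hS)).2.symm
  refine mem_union_right _ (mem_edgesWithTrace.2 ⟨hAF, ?_⟩)
  rw [inter_comm, ← sdiff_sdiff_self_left, ← heq,
    Finset.sdiff_sdiff_eq_self (mem_powersetCard.1 hS).1]

theorem three_mul_le_four_mul_card_edgesWithTrace_add (hW : #W = 2 * n)
    (hcard : n.centralBinom * s ≤ #F)
    (hlight : ∀ T ∈ W.powersetCard n, IsLight n.centralBinom s F T)
    (hS : S ∈ W.powersetCard n) :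
    3 * s ≤ 4 * (#(hittingEdges F (W.powersetCard n)) + #(edgesWithTrace F W S)) := by
  have hlt : #((W.powersetCard n).erase (W \ S)) < n.centralBinom := by
    rw [Nat.centralBinom_eq_two_mul_choose, ← hW, ← card_powersetCard]
    exact card_erase_lt_of_mem (sdiff_mem_powersetCard hW hS)
  refine (three_mul_le_four_mul_card_hittingEdges
    (fun T hT => hlight T (mem_of_mem_erase hT)) hlt hcard).trans (Nat.mul_le_mul_left 4 ?_)
  exact (card_le_card (hittingEdges_erase_sdiff_subset hW hS)).trans (card_union_le _ _)

/-- An edge with trace `T` has one further vertex, so each vertex of `A` lies on at most one. -/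
theorem card_edgesWithTrace_le (hF : (F : Set (Finset α)).Sized (n + 1)) (hT : #T = n)
    (hAT : Disjoint A T) :
    #(edgesWithTrace F W T) ≤ #(disjointEdges (edgesWithTrace F W T) A) + #A := by
  rw [← card_filter_add_card_filter_not (s := edgesWithTrace F W T) (Disjoint · A)]
  refine Nat.add_le_add_left (le_trans (card_le_card (t := A.image (insert · T)) ?_)
    card_image_le) _
  intro B hB
  obtain ⟨hBT, hBA⟩ := mem_filter.1 hB
  obtain ⟨hBF, rfl⟩ := mem_edgesWithTrace.1 hBT
  obtain ⟨z, hzB, hzA⟩ := not_disjoint_iff.1 hBA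
  refine mem_image.2 ⟨z, hzA, eq_of_subset_of_card_le (insert_subset hzB inter_subset_left) ?_⟩
  rw [hF hBF, card_insert_of_notMem (disjoint_left.1 hAT hzA), hT]

theorem card_disjointEdges_edgesWithTrace_add_le {T₁ T₂ : Finset α} (hT : T₁ ≠ T₂) :
    #(disjointEdges (edgesWithTrace F W T₁) A) + #(disjointEdges (edgesWithTrace F W T₂) A) ≤
      #(disjointEdges F A) := by
  have hdisj : Disjoint (disjointEdges (edgesWithTrace F W T₁) A)
      (disjointEdges (edgesWithTrace F W T₂) A) := by
    refine disjoint_left.2 fun B hB₁ hB₂ => hT ?_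
    rw [mem_disjointEdges, mem_edgesWithTrace] at hB₁ hB₂
    exact hB₁.1.2.symm.trans hB₂.1.2
  rw [← card_union_of_disjoint hdisj]
  exact card_le_card (union_subset (filter_subset_filter _ (filter_subset _ F))
    (filter_subset_filter _ (filter_subset _ F)))

theorem le_card_inter_ground_set (hF : (F : Set (Finset α)).Sized (n + 1))
    (hs : ∀ A ∈ F, #(disjointEdges F A) ≤ s) (hW : #W = 2 * n)
    (htrace : ∀ S ∈ W.powersetCard n, 3 * s ≤ 4 * (c + #(edgesWithTrace F W S)))
    (hsc : 4 * (c + (n + 1)) < s) (hA : A ∈ F) : n ≤ #(A ∩ W) := by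
  by_contra! hlt
  have hWA : n < #(W \ A) := by
    have := card_sdiff_add_card_inter W A
    rw [inter_comm] at this
    omega
  obtain ⟨T₁, hT₁, T₂, hT₂, hne⟩ := one_lt_card.1 (one_lt_card_powersetCard hlt.ne_zero hWA)
  rw [mem_powersetCard, subset_sdiff] at hT₁ hT₂
  have hmany₁ := htrace T₁ (mem_powersetCard.2 ⟨hT₁.1.1, hT₁.2⟩)
  have hmany₂ := htrace T₂ (mem_powersetCard.2 ⟨hT₂.1.1, hT₂.2⟩)
  have hfew₁ := card_edgesWithTrace_le (W := W) hF hT₁.2 hT₁.1.2.symm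
  have hfew₂ := card_edgesWithTrace_le (W := W) hF hT₂.2 hT₂.1.2.symm
  have hsum := (card_disjointEdges_edgesWithTrace_add_le (F := F) (W := W) (A := A) hne).trans
    (hs A hA)
  rw [hF hA] at hfew₁ hfew₂
  omega

theorem card_inter_eq_of_forall_le (hW : #W = 2 * n) (hle : ∀ A ∈ F, n ≤ #(A ∩ W)) (hA : A ∈ F)
    (hne : (disjointEdges F A).Nonempty) : #(A ∩ W) = n := by
  obtain ⟨B, hB⟩ := hne
  obtain ⟨hBF, hBA⟩ := mem_disjointEdges.1 hB
  have hunion : #(A ∩ W ∪ B ∩ W) ≤ #W :=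
    card_le_card (union_subset inter_subset_right inter_subset_right)
  rw [card_union_of_disjoint (hBA.symm.mono inter_subset_left inter_subset_left)] at hunion
  have hleA := hle A hA
  have hleB := hle B hBF
  omega

end GroundSet

section DoubleStarFamilies

open Finset

variable {α : Type*} [DecidableEq α] {F : Finset (Finset α)} {A B S T W : Finset α}
  {f : Finset α → Finset α} {n s : ℕ} {x y : α}

theorem mem_doubleStarFamily : B ∈ doubleStarFamily (n + 1) A f ↔
    ∃ S ∈ A.powersetCard n, ∃ x ∈ f S, S ∪ {x} = B := by
  simp only [doubleStarFamily, mem_biUnion, mem_image, Nat.add_sub_cancel]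

theorem union_singleton_inter (hS : S ⊆ A) (hx : x ∉ A) : (S ∪ {x}) ∩ A = S := by
  rw [union_inter_distrib_right, inter_eq_left.2 hS, singleton_inter_of_notMem hx, union_empty]

theorem injOn_union_singleton (hS : Disjoint S T) :
    Set.InjOn (fun x => S ∪ {x}) (T : Set α) := by
  intro y hy z _ hyz
  have hyS : y ∈ S ∪ {z} :=
    (show S ∪ {y} = S ∪ {z} from hyz) ▸ mem_union_right S (mem_singleton_self y)
  exact mem_singleton.1 ((mem_union.1 hyS).resolve_left (disjoint_right.1 hS hy))

theorem disjoint_union_singleton_iff :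
    Disjoint (S ∪ {x}) (T ∪ {y}) ↔ Disjoint S T ∧ x ∉ T ∧ y ∉ S ∧ x ≠ y := by
  simp only [disjoint_union_left, disjoint_union_right, disjoint_singleton_left,
    disjoint_singleton_right, mem_union, mem_singleton, not_or]
  tauto

theorem sized_doubleStarFamily (hf : ∀ S ∈ A.powersetCard n, Disjoint A (f S)) :
    (doubleStarFamily (n + 1) A f : Set (Finset α)).Sized (n + 1) := by
  intro B hB
  obtain ⟨S, hS, x, hx, rfl⟩ := mem_doubleStarFamily.1 hB
  obtain ⟨hSA, hSn⟩ := mem_powersetCard.1 hS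
  rw [card_union_of_disjoint (disjoint_singleton_right.2 fun hxS =>
    disjoint_left.1 (hf S hS) (hSA hxS) hx), hSn, card_singleton]

theorem card_doubleStarFamily (hf : ∀ S ∈ A.powersetCard n, Disjoint A (f S)) :
    #(doubleStarFamily (n + 1) A f) = ∑ S ∈ A.powersetCard n, #(f S) := by
  rw [doubleStarFamily, Nat.add_sub_cancel, card_biUnion]
  · exact sum_congr rfl fun S hS => card_image_of_injOn <|
      injOn_union_singleton ((hf S hS).mono_left (mem_powersetCard.1 hS).1)
  · intro S hS T hT hne
    refine disjoint_left.2 fun B hBS hBT => hne ?_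
    obtain ⟨x, hx, rfl⟩ := mem_image.1 hBS
    obtain ⟨y, hy, hxy⟩ := mem_image.1 hBT
    rw [← union_singleton_inter (mem_powersetCard.1 hS).1 (disjoint_right.1 (hf S hS) hx), ← hxy,
      union_singleton_inter (mem_powersetCard.1 hT).1 (disjoint_right.1 (hf T hT) hy)]

theorem disjointEdges_doubleStarFamily (hA : #A = 2 * n)
    (hf : ∀ S ∈ A.powersetCard n, Disjoint A (f S)) (hS : S ∈ A.powersetCard n) (hx : x ∉ A) :
    disjointEdges (doubleStarFamily (n + 1) A f) (S ∪ {x}) =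
      ((f (A \ S)).erase x).image fun y => (A \ S) ∪ {y} := by
  have hSc : A \ S ∈ A.powersetCard n := sdiff_mem_powersetCard hA hS
  ext B
  rw [mem_disjointEdges, mem_doubleStarFamily, mem_image]
  constructor
  · rintro ⟨⟨T, hT, y, hy, rfl⟩, hd⟩
    obtain ⟨hTS, -, -, hyx⟩ := disjoint_union_singleton_iff.1 hd
    rw [mem_powersetCard] at hT hSc
    obtain rfl : T = A \ S := eq_of_subset_of_card_le (subset_sdiff.2 ⟨hT.1, hTS⟩)
      (hSc.2.trans hT.2.symm).le
    exact ⟨y, mem_erase.2 ⟨hyx, hy⟩, rfl⟩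
  · rintro ⟨y, hy, rfl⟩
    obtain ⟨hyx, hy⟩ := mem_erase.1 hy
    have hyA : y ∉ A := disjoint_right.1 (hf _ hSc) hy
    exact ⟨⟨_, hSc, y, hy, rfl⟩, disjoint_union_singleton_iff.2 ⟨sdiff_disjoint,
      fun h => hyA ((mem_powersetCard.1 hS).1 h), fun h => hx (mem_sdiff.1 h).1, hyx⟩⟩

theorem card_disjointEdges_doubleStarFamily (hA : #A = 2 * n)
    (hf : ∀ S ∈ A.powersetCard n, Disjoint A (f S)) (hS : S ∈ A.powersetCard n) (hx : x ∉ A) :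
    #(disjointEdges (doubleStarFamily (n + 1) A f) (S ∪ {x})) = #((f (A \ S)).erase x) := by
  have hSc : A \ S ∈ A.powersetCard n := sdiff_mem_powersetCard hA hS
  rw [disjointEdges_doubleStarFamily hA hf hS hx]
  exact card_image_of_injOn <| injOn_union_singleton <|
    (hf _ hSc).mono sdiff_subset (erase_subset x _)

theorem isDoubleStarFamily_iff : IsDoubleStarFamily (n + 1) s F ↔
    ∃ (A : Finset α) (f : Finset α → Finset α), #A = 2 * n ∧
      (∀ S ∈ A.powersetCard n, Disjoint A (f S)) ∧
      (∀ S ∈ A.powersetCard n, #(f S) = s + 1 ∧ f S = f (A \ S)) ∧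
      F = doubleStarFamily (n + 1) A f := by
  rw [IsDoubleStarFamily, show 2 * (n + 1) - 2 = 2 * n by omega, Nat.add_sub_cancel]
  constructor
  · rintro ⟨A, B, f, hAB, hA, -, hf, rfl⟩
    simp only [mem_powersetCard (n := s + 1)] at hf
    exact ⟨A, f, hA, fun S hS => hAB.mono_right (hf S hS).1.1,
      fun S hS => ⟨(hf S hS).1.2, (hf S hS).2⟩, rfl⟩
  · rintro ⟨A, f, hA, hAf, hf, rfl⟩
    have hsub : ∀ S ∈ A.powersetCard n, f S ⊆ (A.powersetCard n).biUnion f :=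
      fun S hS => subset_biUnion_of_mem f hS
    obtain ⟨S₀, hS₀⟩ : (A.powersetCard n).Nonempty := powersetCard_nonempty.2 (by omega)
    exact ⟨A, (A.powersetCard n).biUnion f, f, disjoint_biUnion_right _ _ _ |>.2 hAf, hA,
      (hf S₀ hS₀).1 ▸ card_le_card (hsub S₀ hS₀),
      fun S hS => ⟨mem_powersetCard.2 ⟨hsub S hS, (hf S hS).1⟩, (hf S hS).2⟩, rfl⟩

theorem IsDoubleStarFamily.sized (h : IsDoubleStarFamily (n + 1) s F) :
    (F : Set (Finset α)).Sized (n + 1) := by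
  obtain ⟨A, f, -, hAf, -, rfl⟩ := isDoubleStarFamily_iff.1 h
  exact sized_doubleStarFamily hAf

theorem IsDoubleStarFamily.card_eq (h : IsDoubleStarFamily (n + 1) s F) :
    #F = (s + 1) * n.centralBinom := by
  obtain ⟨A, f, hA, hAf, hf, rfl⟩ := isDoubleStarFamily_iff.1 h
  rw [card_doubleStarFamily hAf, sum_const_nat fun S hS => (hf S hS).1, card_powersetCard, hA,
    mul_comm, Nat.centralBinom_eq_two_mul_choose]

theorem isAlmostIntersecting_iff {a b : ℕ} : IsAlmostIntersecting a b F ↔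
    ∀ A ∈ F, a ≤ #(disjointEdges F A) ∧ #(disjointEdges F A) ≤ b := by
  simp only [IsAlmostIntersecting, disjointEdges, disjoint_iff_inter_eq_empty, inter_comm]

theorem IsAlmostIntersecting.mono_left {a a' b : ℕ} (h : IsAlmostIntersecting a b F)
    (ha : a' ≤ a) : IsAlmostIntersecting a' b F :=
  fun A hA => ⟨ha.trans (h A hA).1, (h A hA).2⟩

theorem IsDoubleStarFamily.isAlmostIntersecting (h : IsDoubleStarFamily (n + 1) s F) :
    IsAlmostIntersecting s s F := by
  obtain ⟨A, f, hA, hAf, hf, rfl⟩ := isDoubleStarFamily_iff.1 h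
  refine isAlmostIntersecting_iff.2 fun B hB => ?_
  obtain ⟨S, hS, x, hx, rfl⟩ := mem_doubleStarFamily.1 hB
  have hcard : #((f S).erase x) = s := by
    rw [card_erase_of_mem hx, (hf S hS).1, Nat.add_sub_cancel]
  rw [card_disjointEdges_doubleStarFamily hA hAf hS (disjoint_right.1 (hAf S hS) hx),
    ← (hf S hS).2, hcard]
  exact ⟨le_rfl, le_rfl⟩

theorem card_erase_sdiff_le (hA : #A = 2 * n) (hf : ∀ S ∈ A.powersetCard n, Disjoint A (f S))
    (hs : ∀ B ∈ doubleStarFamily (n + 1) A f, #(disjointEdges (doubleStarFamily (n + 1) A f) B) ≤ s)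
    (hS : S ∈ A.powersetCard n) (hx : x ∈ f S) : #((f (A \ S)).erase x) ≤ s := by
  rw [← card_disjointEdges_doubleStarFamily hA hf hS (disjoint_right.1 (hf S hS) hx)]
  exact hs _ (mem_doubleStarFamily.2 ⟨S, hS, x, hx, rfl⟩)

theorem isDoubleStarFamily_doubleStarFamily (hA : #A = 2 * n)
    (hf : ∀ S ∈ A.powersetCard n, Disjoint A (f S))
    (hne : ∀ S ∈ A.powersetCard n, (f S).Nonempty)
    (hs : ∀ B ∈ doubleStarFamily (n + 1) A f, #(disjointEdges (doubleStarFamily (n + 1) A f) B) ≤ s)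
    (hcard : (s + 1) * n.centralBinom ≤ #(doubleStarFamily (n + 1) A f)) :
    IsDoubleStarFamily (n + 1) s (doubleStarFamily (n + 1) A f) := by
  have herase : ∀ S ∈ A.powersetCard n, ∀ x ∈ f (A \ S), #((f S).erase x) ≤ s := by
    intro S hS x hx
    have := card_erase_sdiff_le hA hf hs (sdiff_mem_powersetCard hA hS) hx
    rwa [Finset.sdiff_sdiff_eq_self (mem_powersetCard.1 hS).1] at this
  have hle : ∀ S ∈ A.powersetCard n, #(f S) ≤ s + 1 := by
    intro S hS
    obtain ⟨x, hx⟩ := hne _ (sdiff_mem_powersetCard hA hS)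
    exact Nat.sub_le_iff_le_add.1 (pred_card_le_card_erase.trans (herase S hS x hx))
  have heq : ∀ S ∈ A.powersetCard n, #(f S) = s + 1 := by
    refine (sum_eq_sum_iff_of_le hle).1 ((sum_le_sum hle).antisymm ?_)
    rw [← card_doubleStarFamily hf, sum_const, card_powersetCard, hA, smul_eq_mul, mul_comm,
      ← Nat.centralBinom_eq_two_mul_choose]
    exact hcard
  have hsub : ∀ S ∈ A.powersetCard n, f (A \ S) ⊆ f S := by
    intro S hS x hx
    by_contra hxS
    have := herase S hS x hx
    rw [erase_eq_of_notMem hxS, heq S hS] at this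
    omega
  refine isDoubleStarFamily_iff.2 ⟨A, f, hA, hf, fun S hS => ⟨heq S hS, Eq.symm ?_⟩, rfl⟩
  exact eq_of_subset_of_card_le (hsub S hS)
    ((heq S hS).trans (heq _ (sdiff_mem_powersetCard hA hS)).symm).le

/-- The link of `S` in `F` outside `W`: the vertices `x ∉ W` for which `S ∪ {x}` is an edge. -/
def link (F : Finset (Finset α)) (W S : Finset α) : Finset α :=
  {x ∈ F.biUnion id \ W | S ∪ {x} ∈ F}

theorem mem_link : x ∈ link F W S ↔ x ∉ W ∧ S ∪ {x} ∈ F := by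
  simp only [link, mem_filter, mem_sdiff, mem_biUnion]
  exact ⟨fun h => ⟨h.1.2, h.2⟩,
    fun h => ⟨⟨⟨_, h.2, mem_union_right S (mem_singleton_self x)⟩, h.1⟩, h.2⟩⟩

theorem exists_mem_link_inter (hA : A ∈ F) (hcard : #A = #(A ∩ W) + 1) :
    ∃ x ∈ link F W (A ∩ W), (A ∩ W) ∪ {x} = A := by
  have hone : #(A \ W) = 1 := by
    have := card_sdiff_add_card_inter A W
    omega
  obtain ⟨x, hx⟩ := card_eq_one.1 hone
  have hxW : x ∉ W := (mem_sdiff.1 (hx ▸ mem_singleton_self x)).2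
  have hunion : (A ∩ W) ∪ {x} = A := by rw [← hx, union_comm, sdiff_union_inter]
  exact ⟨x, mem_link.2 ⟨hxW, hunion.symm ▸ hA⟩, hunion⟩

theorem eq_doubleStarFamily_link (hF : (F : Set (Finset α)).Sized (n + 1))
    (hW : ∀ A ∈ F, #(A ∩ W) = n) : F = doubleStarFamily (n + 1) W (link F W) := by
  ext A
  rw [mem_doubleStarFamily]
  constructor
  · intro hA
    exact ⟨A ∩ W, mem_powersetCard.2 ⟨inter_subset_right, hW A hA⟩,
      exists_mem_link_inter hA (by rw [hF hA, hW A hA])⟩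
  · rintro ⟨S, -, x, hx, rfl⟩
    exact (mem_link.1 hx).2

theorem isDoubleStarFamily_of_card_inter_eq (hF : (F : Set (Finset α)).Sized (n + 1))
    (hs : ∀ A ∈ F, #(disjointEdges F A) ≤ s) (hcard : (s + 1) * n.centralBinom ≤ #F)
    (hW : #W = 2 * n) (hinter : ∀ A ∈ F, #(A ∩ W) = n)
    (hne : ∀ S ∈ W.powersetCard n, (edgesWithTrace F W S).Nonempty) :
    IsDoubleStarFamily (n + 1) s F := by
  have heq := eq_doubleStarFamily_link hF hinter
  rw [heq]
  refine isDoubleStarFamily_doubleStarFamily hW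
    (fun S _ => disjoint_right.2 fun x hx => (mem_link.1 hx).1) (fun S hS => ?_)
    (heq ▸ hs) (heq ▸ hcard)
  obtain ⟨A, hA⟩ := hne S hS
  obtain ⟨hAF, rfl⟩ := mem_edgesWithTrace.1 hA
  obtain ⟨x, hx, -⟩ := exists_mem_link_inter hAF (by rw [hF hAF, hinter A hAF])
  exact ⟨x, hx⟩

theorem isDoubleStarFamily_of_le_card
    (hsc : degreeThreshold n + 4 * (exceptionalBound n + (n + 1)) < s)
    (hF : (F : Set (Finset α)).Sized (n + 1))
    (hFs : IsAlmostIntersecting (degreeThreshold n + 1) s F)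
    (hcard : (s + 1) * n.centralBinom ≤ #F) : IsDoubleStarFamily (n + 1) s F := by
  rw [isAlmostIntersecting_iff] at hFs
  have hs : ∀ A ∈ F, #(disjointEdges F A) ≤ s := fun A hA => (hFs A hA).2
  have hlarge : ∀ A ∈ F, degreeThreshold n < #(disjointEdges F A) := fun A hA => (hFs A hA).1
  have hcard' : n.centralBinom * s ≤ #F :=
    le_trans (by rw [mul_comm]; exact Nat.mul_le_mul_right _ s.le_succ) hcard
  obtain ⟨W, hW, hlight, hexc⟩ := exists_ground_set hF hs hlarge hcard' (by omega)
  have htrace : ∀ S ∈ W.powersetCard n,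
      3 * s ≤ 4 * (exceptionalBound n + #(edgesWithTrace F W S)) := fun S hS =>
    (three_mul_le_four_mul_card_edgesWithTrace_add hW hcard' hlight hS).trans
      (Nat.mul_le_mul_left 4 (Nat.add_le_add_right hexc _))
  have hge : ∀ A ∈ F, n ≤ #(A ∩ W) := fun A hA =>
    le_card_inter_ground_set hF hs hW htrace (by omega) hA
  refine isDoubleStarFamily_of_card_inter_eq hF hs hcard hW
    (fun A hA => card_inter_eq_of_forall_le hW hge hA (card_pos.1 (hlarge A hA).pos))
    fun S hS => card_pos.1 ?_
  have := htrace S hS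
  omega

end DoubleStarFamilies

theorem theorem3p1_general (k : ℕ) (hk : 0 < k) :
    ∃ R s₀ : ℕ, ∀ s : ℕ, s₀ < s → ∀ (V : Type*) [DecidableEq V],
      (∀ F : Finset (Finset V), (F : Set (Finset V)).Sized k → IsAlmostIntersecting R s F →
        F.card ≤ (s + 1) * (2 * k - 2).choose (k - 1)) ∧
      (∀ F : Finset (Finset V),
        ((F : Set (Finset V)).Sized k ∧ IsAlmostIntersecting R s F ∧
          F.card = (s + 1) * (2 * k - 2).choose (k - 1)) ↔ IsDoubleStarFamily k s F) ∧
      (∀ F : Finset (Finset V), IsDoubleStarFamily k s F → IsAlmostIntersecting s s F) := by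
  obtain ⟨n, rfl⟩ := Nat.exists_eq_add_one_of_ne_zero hk.ne'
  have hbinom : (2 * (n + 1) - 2).choose (n + 1 - 1) = n.centralBinom := rfl
  simp only [hbinom]
  refine ⟨degreeThreshold n + 1, degreeThreshold n + 4 * (exceptionalBound n + (n + 1)),
    fun s hs V _ => ⟨fun F hF hFs => ?_, fun F => ⟨fun ⟨hF, hFs, hcard⟩ => ?_, fun h => ?_⟩,
      fun F h => h.isAlmostIntersecting⟩⟩
  · refine le_of_not_gt fun hlt => hlt.ne' ?_
    exact (isDoubleStarFamily_of_le_card hs hF hFs hlt.le).card_eq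
  · exact isDoubleStarFamily_of_le_card hs hF hFs hcard.ge
  · exact ⟨h.sized, h.isAlmostIntersecting.mono_left (by omega), h.card_eq⟩

theorem theorem3p1 (k : ℕ) (hk : 2 < k) :
    ∃ R s₀ : ℕ, ∀ s : ℕ, s₀ < s → ∀ (V : Type*) [DecidableEq V],
      (∀ F : Finset (Finset V), (F : Set (Finset V)).Sized k → IsAlmostIntersecting R s F →
        F.card ≤ (s + 1) * (2 * k - 2).choose (k - 1)) ∧
      (∀ F : Finset (Finset V),
        ((F : Set (Finset V)).Sized k ∧ IsAlmostIntersecting R s F ∧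
          F.card = (s + 1) * (2 * k - 2).choose (k - 1)) ↔ IsDoubleStarFamily k s F) ∧
      (∀ F : Finset (Finset V), IsDoubleStarFamily k s F → IsAlmostIntersecting s s F) :=
  theorem3p1_general k (by omega)
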